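/- **Setting.** Let $\mathcal J$ be a finite set of resources with capacities $C_j>0$ ($j\in\mathcal J$), and let $\mathcal I$ be a finite set of routes, each route $i$ using a nonempty set of resources. Let $A_{ji}=1$ if route $i$ uses resource $j$ and $A_{ji}=0$ otherwise, and assume that the matrix $A$ has rank $|\mathcal J|$. Let $\alpha\in(0,\infty)$, and for each $i\in\mathcal I$ let $\kappa_i,\nu_i,\mu_i>0$ and $\rho_i=\nu_i/\mu_i$. Assume that $\sum_{i}A_{ji}\rho_i\le C_j$ for all $j\in\mathcal J$, with equality for at least one $j$. For $n\in\mathbb R_+^{\mathcal I}$ let $\mathcal I_+(n)=\{i:n_i>0\}$ and $\mathcal I_0(n)=\{i:n_i=0\}$. The weighted $\alpha$-fair allocation $\Lambda(n)\in\mathbb R_+^{\mathcal I}$ is defined by $\Lambda_i(n)=0$ for $i\in\mathcal I_0(n)$, and by letting $(\Lambda_i(n))_{i\in\mathcal I_+(n)}$ be the unique maximizer of $$G_n(\Lambda)=\begin{cases}\sum_{i\in\mathcal I_+(n)}\kappa_i n_i^{\alpha}\dfrac{\Lambda_i^{1-\alpha}}{1-\alpha}, & \alpha\ne1,\\[1ex]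 \sum_{i\in\mathcal I_+(n)}\kappa_i n_i\log\Lambda_i, & \alpha=1,\end{cases}$$ over all $\Lambda_i\ge0$ ($i\in\mathcal I_+(n)$) with $\sum_{i\in\mathcal I_+(n)}A_{ji}\Lambda_i\le C_j$ for all $j\in\mathcal J$, where $G_n(\Lambda)=-\infty$ if $\alpha\ge1$ and $\Lambda_i=0$ for some $i\in\mathcal I_+(n)$. A *fluid model solution* is a function $n:[0,\infty)\to\mathbb R_+^{\mathcal I}$, each component of which is absolutely continuous (on every compact interval $[0,T]$), such that at each $t>0$ at which all components of $n$ are differentiable, $$\frac{d}{dt}n_i(t)=\begin{cases}\nu_i-\mu_i\Lambda_i(n(t)), & n_i(t)>0,\\ 0, & n_i(t)=0,\end{cases}\qquad i\in\mathcal I,$$ $$\sum_{i\in\mathcal I_+(n(t))}A_{ji}\Lambda_i(n(t))+\sum_{i\in\mathcal I_0(n(t))}A_{ji}\rho_i\le C_j,\qquad j\in\mathcal J.$$ The *invariant manifold* $\mathcal M_\alpha$ is the set of all $n_0\in\mathbb R_+^{\mathcal I}$ for which there is a fluid model solution with $n(t)=n_0$ for all $t\ge0$. With $\|\cdot\|$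 the Euclidean norm, let $d(\mathcal M_\alpha,n)=\inf\{\|v-n\|:v\in\mathcal M_\alpha\}$. **Theorem 5.2.** Fix $R\in(0,\infty)$ and $\varepsilon>0$. There is a constant $T_{R,\varepsilon}\in[0,\infty)$ such that for each fluid model solution $n(\cdot)$ satisfying $\|n(0)\|\le R$, $$d(\mathcal M_\alpha,n(t))<\varepsilon\qquad\text{for all } t>T_{R,\varepsilon}.$$ -/

import Mathlib

open scoped BigOperators

noncomputable section

namespace FairSharing

/-- The resource-route incidence matrix: entry `(j, i)` is `1` if route `i` uses resource `j`,
and `0` otherwise. -/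
def incidence {J I : Type*} [DecidableEq J] (route : I → Finset J) : Matrix J I ℝ :=
  Matrix.of fun j i => if j ∈ route i then 1 else 0

/-- The data of a flow-level bandwidth sharing model with resources `J` and routes `I`, in the
critical regime: the nominal load of no resource exceeds its capacity, and the load of at least
one resource equals its capacity. -/
structure Network (J I : Type*) [Fintype J] [DecidableEq J] [Fintype I] where
  /-- the set of resources used by each route -/
  route : I → Finset J
  route_nonempty : ∀ i, (route i).Nonempty
  /-- the incidence matrix has full row rank -/
  full_row_rank : (incidence route).rank = Fintype.card J
  /-- capacities -/
  C : J → ℝ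
  C_pos : ∀ j, 0 < C j
  /-- the fairness parameter -/
  α : ℝ
  α_pos : 0 < α
  /-- weights -/
  κ : I → ℝ
  κ_pos : ∀ i, 0 < κ i
  /-- arrival rates -/
  ν : I → ℝ
  ν_pos : ∀ i, 0 < ν i
  /-- the parameters of the exponential document sizes -/
  μ : I → ℝ
  μ_pos : ∀ i, 0 < μ i
  load_le : ∀ j, ∑ i, incidence route j i * (ν i / μ i) ≤ C j
  critical : ∃ j, ∑ i, incidence route j i * (ν i / μ i) = C j

namespace Network

variable {J I : Type*} [Fintype J] [DecidableEq J] [Fintype I]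

/-- The incidence matrix of the network. -/
def A (N : Network J I) : Matrix J I ℝ := incidence N.route

/-- The average load `ρ i = ν i / μ i` produced by route `i`. -/
def ρ (N : Network J I) (i : I) : ℝ := N.ν i / N.μ i

/-- The routes on which the state `n` is positive. -/
def active (n : EuclideanSpace ℝ I) : Finset I := Finset.univ.filter fun i => 0 < n i

/-- The routes on which the state `n` vanishes. -/
def inactive (n : EuclideanSpace ℝ I) : Finset I := Finset.univ.filter fun i => n i = 0

/-- The objective of the bandwidth sharing problem in state `n`; only the entries `Λ i` with
`i` active matter. Its value is `-∞` if `1 ≤ α` and `Λ i = 0` for some active `i`. -/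
def objective (N : Network J I) (n : EuclideanSpace ℝ I) (Λ : I → ℝ) : EReal :=
  open Classical in
  if 1 ≤ N.α ∧ ∃ i ∈ active n, Λ i = 0 then ⊥
  else if N.α = 1 then
    ((∑ i ∈ active n, N.κ i * n i * Real.log (Λ i) : ℝ) : EReal)
  else
    ((∑ i ∈ active n, N.κ i * n i ^ N.α * (Λ i ^ (1 - N.α) / (1 - N.α)) : ℝ) : EReal)

/-- The feasible allocations in state `n`, extended by `0` to the routes that are not active. -/
def feasible (N : Network J I) (n : EuclideanSpace ℝ I) : Set (I → ℝ) :=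
  {Λ | (∀ i, 0 ≤ Λ i) ∧ (∀ i, i ∉ active n → Λ i = 0) ∧
    ∀ j, ∑ i ∈ active n, N.A j i * Λ i ≤ N.C j}

/-- `Λ` is a weighted `α`-fair allocation in state `n`. -/
def IsFairAllocation (N : Network J I) (n : EuclideanSpace ℝ I) (Λ : I → ℝ) : Prop :=
  Λ ∈ N.feasible n ∧ ∀ Λ' ∈ N.feasible n, N.objective n Λ' ≤ N.objective n Λ

/-- The weighted `α`-fair allocation in state `n`, the (unique) solution of the bandwidth
sharing problem. -/
def allocation (N : Network J I) (n : EuclideanSpace ℝ I) : I → ℝ :=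
  Classical.epsilon (N.IsFairAllocation n)

/-- `n`, restricted to times `t ≥ 0`, is a fluid model solution. Absolute continuity on `[0, ∞)`
is absolute continuity on each compact interval `[0, T]`. The differential relations are imposed
at the regular points `t > 0`, those where all components are differentiable. The values of `n`
at negative times are irrelevant. -/
structure IsFluidSolution (N : Network J I) (n : ℝ → EuclideanSpace ℝ I) : Prop where
  nonneg : ∀ t, 0 ≤ t → ∀ i, 0 ≤ n t i
  absolutelyContinuous :
    ∀ i, ∀ T, 0 ≤ T → AbsolutelyContinuousOnInterval (fun t => n t i) 0 T
  deriv_of_pos : ∀ t, 0 < t → (∀ i, DifferentiableAt ℝ (fun s => n s i) t) →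
    ∀ i, 0 < n t i → deriv (fun s => n s i) t = N.ν i - N.μ i * N.allocation (n t) i
  deriv_of_eq_zero : ∀ t, 0 < t → (∀ i, DifferentiableAt ℝ (fun s => n s i) t) →
    ∀ i, n t i = 0 → deriv (fun s => n s i) t = 0
  capacity : ∀ t, 0 < t → (∀ i, DifferentiableAt ℝ (fun s => n s i) t) →
    ∀ j, ∑ i ∈ active (n t), N.A j i * N.allocation (n t) i
      + ∑ i ∈ inactive (n t), N.A j i * N.ρ i ≤ N.C j

/-- The invariant manifold: the states at which some fluid model solution stays for all times. -/
def invariantManifold (N : Network J I) : Set (EuclideanSpace ℝ I) :=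
  {n₀ | (∀ i, 0 ≤ n₀ i) ∧ ∃ n, N.IsFluidSolution n ∧ ∀ t, 0 ≤ t → n t = n₀}

end Network

end FairSharing

end

/-!
The argument rests on the Lyapunov function `Φ = lyapunov`, a weighted sum of the `n i ^ (α + 1)`,
chosen such that `∂Φ/∂n i = marginal n i / μ i`, where `marginal n` is the gradient at `ρ` of the
objective in state `n`. Along a fluid model solution `Φ` therefore decreases at the rate
`drift n = ∑ i, marginal n i * (Λ i(n) - ρ i)`. As the objective is concave, `Λ(n)` is optimal and
`ρ` is feasible, the drift is nonnegative, and it is positive off the invariant manifold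
(`drift_pos`, `mem_invariantManifold`).

A positive drift alone does not keep a solution near the manifold once it has come close, since
`Φ` is not constant on the manifold. The second monotone quantity is the workload of the resources
of critical load, which does not decrease along solutions (`IsFluidSolution.workload_le`). Say that
`m` improves on `n` by `η` if `m` has at least the critical workloads of `n` and
`Φ m ≤ Φ n - η` (`ImprovesBy`). Then:

* A state `n` with `Φ n ≤ B` at distance at least `ε` from the manifold is improved by some
  `η(B, ε) > 0` (`exists_improvesBy`). Off the manifold, a small step in the direction
  `μ (ρ - Λ(n))` is an improvement, and compactness makes `η` uniform.
* If some `m` improves on `n` by `η`, then `drift n ≥ δ(B, η) > 0` (`exists_pos_le_drift`). Indeed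
  `ρ + s (n - m) / μ` is a feasible allocation for small `s > 0`, and by convexity of `Φ` its
  objective exceeds that of `ρ` by about `s η`.

If `n t` is at distance at least `ε` from the manifold, then any `m` that improves on `n t` also
improves on `n s` for all `s ≤ t`, because `Φ` and the workloads are monotone in time. So the drift
is at least `δ` on all of `[0, t]`, whence `0 ≤ Φ (n t) ≤ Φ (n 0) - δ t`, which bounds `t`.
-/

open Filter Topology

/-! ### Isoelastic utility and convexity of powers -/

/-- The isoelastic utility function with parameter `α`, whose derivative on `(0, ∞)` is
`x ^ (-α)`. -/
noncomputable def isoelasticUtility (α x : ℝ) : ℝ :=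
  open Classical in if α = 1 then Real.log x else x ^ (1 - α) / (1 - α)

theorem hasDerivAt_isoelasticUtility (α : ℝ) {x : ℝ} (hx : 0 < x) :
    HasDerivAt (isoelasticUtility α) (x ^ (-α)) x := by
  unfold isoelasticUtility
  split_ifs with h
  · subst h
    simpa [Real.rpow_neg_one] using Real.hasDerivAt_log hx.ne'
  · have h1 : 1 - α ≠ 0 := sub_ne_zero.2 (Ne.symm h)
    have := (Real.hasDerivAt_rpow_const (x := x) (p := 1 - α) (Or.inl hx.ne')).div_const (1 - α)
    convert! this using 1
    rw [show 1 - α - 1 = -α by ring]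
    field_simp

theorem continuousAt_isoelasticUtility (α : ℝ) {x : ℝ} (hx : 0 ≤ x) (h : 1 ≤ α → 0 < x) :
    ContinuousAt (isoelasticUtility α) x := by
  rcases hx.eq_or_lt with rfl | hx
  · have hα : α < 1 := by
      by_contra hα
      exact lt_irrefl _ (h (not_lt.1 hα))
    unfold isoelasticUtility
    simp only [hα.ne, if_false]
    exact (Real.continuousAt_rpow_const 0 (1 - α) (Or.inr (by linarith))).div_const _
  · exact (hasDerivAt_isoelasticUtility α hx).continuousAt

/-- Strict concavity of the isoelastic utility: its graph lies strictly below its tangent at `r`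
away from `r`. The value at `0` is covered if it is finite, that is, if `α < 1`. -/
theorem isoelasticUtility_lt_tangent {α r x : ℝ} (hα : 0 < α) (hr : 0 < r) (hx : 0 ≤ x)
    (h : 1 ≤ α → 0 < x) (hxr : x ≠ r) :
    isoelasticUtility α x < isoelasticUtility α r + r ^ (-α) * (x - r) := by
  have hcont : ∀ y, min x r ≤ y → ContinuousAt (isoelasticUtility α) y := fun y hy =>
    continuousAt_isoelasticUtility α ((le_min hx hr.le).trans hy)
      fun h1 => (lt_min (h h1) hr).trans_le hy
  rcases hxr.lt_or_gt with hlt | hlt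
  · obtain ⟨c, hc, hc'⟩ := exists_hasDerivAt_eq_slope (isoelasticUtility α) (fun y => y ^ (-α)) hlt
      (fun y hy => (hcont y (by simp [hy.1])).continuousWithinAt)
      (fun y hy => hasDerivAt_isoelasticUtility α (hx.trans_lt hy.1))
    have hlt' : r ^ (-α) < c ^ (-α) :=
      Real.rpow_lt_rpow_of_neg (hx.trans_lt hc.1) hc.2 (by linarith)
    have h0 : 0 < r - x := by linarith
    rw [hc', lt_div_iff₀ h0] at hlt'
    linarith
  · obtain ⟨c, hc, hc'⟩ := exists_hasDerivAt_eq_slope (isoelasticUtility α) (fun y => y ^ (-α)) hlt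
      (fun y hy => (hcont y (by simp [hy.1])).continuousWithinAt)
      (fun y hy => hasDerivAt_isoelasticUtility α (hr.trans hy.1))
    have hlt' : c ^ (-α) < r ^ (-α) :=
      Real.rpow_lt_rpow_of_neg hr hc.1 (by linarith)
    have h0 : 0 < x - r := by linarith
    rw [hc', div_lt_iff₀ h0] at hlt'
    linarith

theorem isoelasticUtility_le_tangent {α r x : ℝ} (hα : 0 < α) (hr : 0 < r) (hx : 0 ≤ x)
    (h : 1 ≤ α → 0 < x) :
    isoelasticUtility α x ≤ isoelasticUtility α r + r ^ (-α) * (x - r) := by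
  rcases eq_or_ne x r with rfl | hxr
  · simp
  · exact (isoelasticUtility_lt_tangent hα hr hx h hxr).le

theorem tendsto_isoelasticUtility_nhdsGT_zero {α : ℝ} (hα : 1 ≤ α) :
    Tendsto (isoelasticUtility α) (𝓝[>] 0) atBot := by
  unfold isoelasticUtility
  split_ifs with h
  · exact Real.tendsto_log_nhdsGT_zero
  · have h1 : 1 - α < 0 := by
      have := lt_of_le_of_ne hα (Ne.symm h)
      linarith
    exact (tendsto_rpow_neg_nhdsGT_zero h1).atTop_div_const_of_neg h1

/-- The first order expansion of the isoelastic utility at `r`, uniformly over bounded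
directions `y`. -/
theorem eventually_isoelasticUtility_expansion (α : ℝ) {r : ℝ} (hr : 0 < r) (Y : ℝ) {e : ℝ}
    (he : 0 < e) : ∀ᶠ s in 𝓝[>] (0 : ℝ), ∀ y, |y| ≤ Y →
      0 < r + s * y ∧
        isoelasticUtility α r + s * (r ^ (-α) * y - e) ≤ isoelasticUtility α (r + s * y) := by
  have hY : 0 < |Y| + 1 := by positivity
  have hd := (hasDerivAt_isoelasticUtility α hr).isLittleO.def (div_pos he hY)
  obtain ⟨d, hd0, hd⟩ := Metric.eventually_nhds_iff.1 (hd.and (lt_mem_nhds hr))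
  have hs0 : ∀ᶠ s in 𝓝[>] (0 : ℝ), s < d / (|Y| + 1) :=
    nhdsWithin_le_nhds (gt_mem_nhds (div_pos hd0 hY))
  filter_upwards [hs0, self_mem_nhdsWithin] with s hs hs' y hy
  have hs' : 0 < s := hs'
  rw [lt_div_iff₀ hY] at hs
  have hy' : |y| ≤ |Y| + 1 := by linarith [le_abs_self Y]
  have hsy : |s * y| ≤ s * (|Y| + 1) := by
    rw [abs_mul, abs_of_pos hs']
    gcongr
  obtain ⟨h1, h2⟩ := hd (y := r + s * y) (by simpa [Real.dist_eq] using hsy.trans_lt hs)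
  refine ⟨h2, ?_⟩
  simp only [add_sub_cancel_left, smul_eq_mul, Real.norm_eq_abs] at h1
  have h3 : e / (|Y| + 1) * |s * y| ≤ s * e := by
    calc _ ≤ e / (|Y| + 1) * (s * (|Y| + 1)) := by gcongr
      _ = s * e := by field_simp
  have := (abs_le.1 (h1.trans h3)).1
  nlinarith [this]

/-- Convexity of `x ↦ x ^ (α + 1)`, in the form of the tangent inequality. -/
theorem rpow_add_one_tangent_le {α x y : ℝ} (hα : 0 < α) (hx : 0 ≤ x) (hy : 0 ≤ y) :
    x ^ (α + 1) + (α + 1) * x ^ α * (y - x) ≤ y ^ (α + 1) := by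
  rcases hx.eq_or_lt with rfl | hx
  · rw [Real.zero_rpow hα.ne', Real.zero_rpow (by linarith)]
    simpa using Real.rpow_nonneg hy _
  · have h := one_add_mul_self_le_rpow_one_add (s := y / x - 1) (p := α + 1)
      (by linarith [div_nonneg hy hx.le]) (by linarith)
    rw [add_sub_cancel, Real.div_rpow hy hx.le, le_div_iff₀ (Real.rpow_pos_of_pos hx _)] at h
    refine le_trans (le_of_eq ?_) h
    rw [Real.rpow_add_one hx.ne']
    field_simp

/-! ### Absolutely continuous functions -/

theorem LipschitzOnWith.comp_absolutelyContinuousOnInterval {f g : ℝ → ℝ} {s : Set ℝ}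
    {K : NNReal} {a b : ℝ} (hg : LipschitzOnWith K g s) (hf : AbsolutelyContinuousOnInterval f a b)
    (hs : Set.MapsTo f (Set.uIcc a b) s) :
    AbsolutelyContinuousOnInterval (fun t => g (f t)) a b := by
  rw [absolutelyContinuousOnInterval_iff] at hf ⊢
  intro ε hε
  obtain ⟨δ, hδ, h⟩ := hf (ε / (K + 1)) (by positivity)
  refine ⟨δ, hδ, fun E hE hE' => ?_⟩
  have h1 := h E hE hE'
  rw [lt_div_iff₀ (by positivity)] at h1
  refine lt_of_le_of_lt ?_ h1
  rw [Finset.sum_mul]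
  refine Finset.sum_le_sum fun i hi => ?_
  obtain ⟨hm, -⟩ := hE
  have := hg.dist_le_mul _ (hs (hm i hi).1) _ (hs (hm i hi).2)
  nlinarith [dist_nonneg (x := f (E.2 i).1) (y := f (E.2 i).2)]

theorem AbsolutelyContinuousOnInterval.rpow_const {f : ℝ → ℝ} {a b p : ℝ} (hp : 1 ≤ p)
    (hf : AbsolutelyContinuousOnInterval f a b) :
    AbsolutelyContinuousOnInterval (fun t => f t ^ p) a b := by
  obtain ⟨B, hB⟩ := hf.exists_bound
  have hc : ContDiff ℝ 1 fun x : ℝ => x ^ p := by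
    simpa using Real.contDiff_rpow_const_of_le (n := 1) (p := p) (by simpa using hp)
  obtain ⟨K, hK⟩ := hc.contDiffOn.exists_lipschitzOnWith (s := Set.Icc (-B) B) (by decide)
    (convex_Icc _ _) isCompact_Icc
  exact hK.comp_absolutelyContinuousOnInterval hf fun t ht => abs_le.1 (hB t ht)

theorem AbsolutelyContinuousOnInterval.fun_sum {ι : Type*} {s : Finset ι} {f : ι → ℝ → ℝ}
    {a b : ℝ} (hf : ∀ i ∈ s, AbsolutelyContinuousOnInterval (f i) a b) :
    AbsolutelyContinuousOnInterval (fun t => ∑ i ∈ s, f i t) a b := by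
  classical
  induction s using Finset.induction_on with
  | empty =>
    simpa using (LipschitzWith.const (0 : ℝ)).lipschitzOnWith.absolutelyContinuousOnInterval
      (a := a) (b := b)
  | insert i s hi ih =>
    simp only [Finset.sum_insert hi]
    exact (hf i (by simp)).add (ih fun k hk => hf k (by simp [hk]))

theorem AbsolutelyContinuousOnInterval.sub_le_of_ae_deriv_le {f : ℝ → ℝ} {a b c : ℝ} (hab : a ≤ b)
    (hf : AbsolutelyContinuousOnInterval f a b)
    (h : ∀ᵐ t, t ∈ Set.Ioo a b → deriv f t ≤ c) : f b - f a ≤ c * (b - a) := by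
  rw [← hf.integral_deriv_eq_sub]
  calc _ ≤ ∫ _ in a..b, c := by
        refine intervalIntegral.integral_mono_ae_restrict hab hf.intervalIntegrable_deriv
          intervalIntegrable_const ?_
        rw [← MeasureTheory.restrict_Ioo_eq_restrict_Icc]
        exact (MeasureTheory.ae_restrict_iff' measurableSet_Ioo).2 h
    _ = c * (b - a) := by simp [mul_comm]

namespace FairSharing.Network

variable {J I : Type*} [Fintype J] [DecidableEq J] [Fintype I] (N : Network J I)

/-! ### The fair allocation -/

theorem A_nonneg (j : J) (i : I) : 0 ≤ N.A j i := by
  unfold A incidence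
  simp only [Matrix.of_apply]
  split_ifs <;> norm_num

theorem ρ_pos (i : I) : 0 < N.ρ i := div_pos (N.ν_pos i) (N.μ_pos i)

theorem sum_A_mul_ρ_le (j : J) : ∑ i, N.A j i * N.ρ i ≤ N.C j := N.load_le j

theorem mem_active {n : EuclideanSpace ℝ I} {i : I} : i ∈ active n ↔ 0 < n i := by
  simp [active]

theorem mem_inactive {n : EuclideanSpace ℝ I} {i : I} : i ∈ inactive n ↔ n i = 0 := by
  simp [inactive]

theorem eq_zero_of_notMem_active {n : EuclideanSpace ℝ I} (hn : ∀ i, 0 ≤ n i) {i : I}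
    (hi : i ∉ active n) : n i = 0 :=
  le_antisymm (not_lt.1 fun h => hi (mem_active.2 h)) (hn i)

theorem sum_active_add_sum_inactive {n : EuclideanSpace ℝ I} (hn : ∀ i, 0 ≤ n i) (f : I → ℝ) :
    ∑ i ∈ active n, f i + ∑ i ∈ inactive n, f i = ∑ i, f i := by
  classical
  rw [← Finset.sum_filter_add_sum_filter_not Finset.univ (fun i => 0 < n i) f]
  congr 2
  ext i
  simp [inactive, (hn i).ge_iff_eq]
  exact eq_comm

/-- The real-valued version of the objective. The sum extends over all routes, as the routes `i`
with `n i = 0` contribute `0`. -/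
noncomputable def gain (n : EuclideanSpace ℝ I) (Λ : I → ℝ) : ℝ :=
  ∑ i, N.κ i * n i ^ N.α * isoelasticUtility N.α (Λ i)

theorem gain_eq_sum_active {n : EuclideanSpace ℝ I} (hn : ∀ i, 0 ≤ n i) (Λ : I → ℝ) :
    N.gain n Λ = ∑ i ∈ active n, N.κ i * n i ^ N.α * isoelasticUtility N.α (Λ i) := by
  unfold gain
  refine (Finset.sum_subset (Finset.subset_univ _) fun i _ hi => ?_).symm
  rw [eq_zero_of_notMem_active hn hi, Real.zero_rpow N.α_pos.ne']
  ring

theorem gain_congr {n : EuclideanSpace ℝ I} (hn : ∀ i, 0 ≤ n i) {Λ Λ' : I → ℝ}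
    (h : ∀ i ∈ active n, Λ i = Λ' i) : N.gain n Λ = N.gain n Λ' := by
  rw [N.gain_eq_sum_active hn, N.gain_eq_sum_active hn]
  exact Finset.sum_congr rfl fun i hi => by rw [h i hi]

theorem objective_eq_gain {n : EuclideanSpace ℝ I} (hn : ∀ i, 0 ≤ n i) {Λ : I → ℝ}
    (hΛ : 1 ≤ N.α → ∀ i ∈ active n, Λ i ≠ 0) : N.objective n Λ = (N.gain n Λ : EReal) := by
  rw [N.gain_eq_sum_active hn]
  unfold objective isoelasticUtility
  rw [if_neg (by rintro ⟨h1, i, hi, h0⟩; exact hΛ h1 i hi h0)]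
  split_ifs with h
  · simp [h]
  · rfl

theorem objective_eq_bot {n : EuclideanSpace ℝ I} {Λ : I → ℝ} (h1 : 1 ≤ N.α) {i : I}
    (hi : i ∈ active n) (h0 : Λ i = 0) : N.objective n Λ = ⊥ := by
  unfold objective
  rw [if_pos ⟨h1, i, hi, h0⟩]

theorem le_sum_C_of_mem_feasible {n : EuclideanSpace ℝ I} {Λ : I → ℝ} (h : Λ ∈ N.feasible n)
    (i : I) : Λ i ≤ ∑ j, N.C j := by
  obtain ⟨h0, h1, h2⟩ := h
  by_cases hi : i ∈ active n
  · obtain ⟨j, hj⟩ := N.route_nonempty i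
    calc Λ i = N.A j i * Λ i := by simp [A, incidence, hj]
      _ ≤ ∑ i ∈ active n, N.A j i * Λ i :=
        Finset.single_le_sum (fun k _ => mul_nonneg (N.A_nonneg j k) (h0 k)) hi
      _ ≤ N.C j := h2 j
      _ ≤ ∑ j, N.C j := Finset.single_le_sum (fun k _ => (N.C_pos k).le) (Finset.mem_univ j)
  · rw [h1 i hi]
    exact Finset.sum_nonneg fun k _ => (N.C_pos k).le

theorem isCompact_feasible (n : EuclideanSpace ℝ I) : IsCompact (N.feasible n) := by
  refine (isCompact_Icc (a := (0 : I → ℝ)) (b := fun _ => ∑ j, N.C j)).of_isClosed_subset ?_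
    fun Λ h => ⟨h.1, N.le_sum_C_of_mem_feasible h⟩
  have : N.feasible n = (⋂ i, {Λ | 0 ≤ Λ i}) ∩ (⋂ i, ⋂ (_ : i ∉ active n), {Λ | Λ i = 0}) ∩
      ⋂ j, {Λ | ∑ i ∈ active n, N.A j i * Λ i ≤ N.C j} := by
    ext Λ
    simp [feasible, and_assoc]
  rw [this]
  refine ((isClosed_iInter fun i => ?_).inter (isClosed_iInter fun i => isClosed_iInter fun _ => ?_)
    ).inter (isClosed_iInter fun j => ?_)
  · exact isClosed_le continuous_const (continuous_apply i)
  · exact isClosed_eq (continuous_apply i) continuous_const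
  · exact isClosed_le (by fun_prop) continuous_const

theorem indicator_mem_feasible (n : EuclideanSpace ℝ I) {Λ : I → ℝ} (h0 : ∀ i, 0 ≤ Λ i)
    (hC : ∀ j, ∑ i, N.A j i * Λ i ≤ N.C j) :
    (active n : Set I).indicator Λ ∈ N.feasible n := by
  refine ⟨fun i => Set.indicator_nonneg (fun i _ => h0 i) i, fun i hi => by simp [hi], fun j => ?_⟩
  refine le_trans ?_ (hC j)
  rw [Finset.sum_congr rfl fun i hi => by rw [Set.indicator_of_mem (Finset.mem_coe.2 hi)]]
  exact Finset.sum_le_sum_of_subset_of_nonneg (Finset.subset_univ _)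
    fun i _ _ => mul_nonneg (N.A_nonneg j i) (h0 i)

theorem gain_indicator {n : EuclideanSpace ℝ I} (hn : ∀ i, 0 ≤ n i) (Λ : I → ℝ) :
    N.gain n ((active n : Set I).indicator Λ) = N.gain n Λ :=
  N.gain_congr hn fun _ hi => Set.indicator_of_mem (Finset.mem_coe.2 hi) _

theorem continuousOn_gain {n : EuclideanSpace ℝ I} (hn : ∀ i, 0 ≤ n i) {S : Set (I → ℝ)}
    (hS : ∀ Λ ∈ S, ∀ i ∈ active n, 0 ≤ Λ i ∧ (1 ≤ N.α → 0 < Λ i)) :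
    ContinuousOn (N.gain n) S := by
  rw [funext (N.gain_eq_sum_active hn)]
  refine continuousOn_finsetSum _ fun i hi Λ hΛ => ContinuousAt.continuousWithinAt ?_
  refine continuousAt_const.mul (ContinuousAt.comp' ?_ (continuous_apply i).continuousAt)
  exact continuousAt_isoelasticUtility _ (hS Λ hΛ i hi).1 (hS Λ hΛ i hi).2

/-- If `1 ≤ α`, a feasible allocation that is close to `0` on some active route is worse than
the load vector `ρ`. -/
theorem exists_pos_gain_lt_gain_ρ {n : EuclideanSpace ℝ I} (hn : ∀ i, 0 ≤ n i) (hα : 1 ≤ N.α) :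
    ∃ l > 0, ∀ Λ ∈ N.feasible n, (∀ i ∈ active n, 0 < Λ i) →
      (∃ i ∈ active n, Λ i < l) → N.gain n Λ < N.gain n N.ρ := by
  classical
  set w : I → ℝ := fun i => N.κ i * n i ^ N.α with hw
  have hw0 : ∀ i, 0 ≤ w i := fun i => mul_nonneg (N.κ_pos i).le (Real.rpow_nonneg (hn i) _)
  have hw1 : ∀ i ∈ active n, 0 < w i := fun i hi =>
    mul_pos (N.κ_pos i) (Real.rpow_pos_of_pos (mem_active.1 hi) _)
  set B : ℝ := |isoelasticUtility N.α 1| + ∑ j, N.C j with hB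
  have hC0 : 0 ≤ ∑ j, N.C j := Finset.sum_nonneg fun k _ => (N.C_pos k).le
  have hB0 : 0 ≤ B := by positivity
  have hev : ∀ᶠ x in 𝓝[>] (0 : ℝ), ∀ i ∈ active n,
      w i * isoelasticUtility N.α x < N.gain n N.ρ - (∑ i, w i) * B := by
    rw [Filter.eventually_all_finset]
    intro i hi
    exact ((tendsto_isoelasticUtility_nhdsGT_zero hα).const_mul_atBot (hw1 i hi)).eventually_lt_atBot
      _
  obtain ⟨l, hl0, hl⟩ := mem_nhdsGT_iff_exists_Ioo_subset.1 hev
  refine ⟨l, hl0, fun Λ hΛ hpos ⟨i, hi, hil⟩ => ?_⟩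
  have h1 := hl ⟨hpos i hi, hil⟩ i hi
  have hle : ∀ k ∈ active n, isoelasticUtility N.α (Λ k) ≤ B := fun k hk => by
    have := isoelasticUtility_le_tangent N.α_pos one_pos (hpos k hk).le (fun _ => hpos k hk)
    rw [Real.one_rpow] at this
    linarith [le_abs_self (isoelasticUtility N.α 1), N.le_sum_C_of_mem_feasible hΛ k]
  rw [N.gain_eq_sum_active hn, ← Finset.add_sum_erase _ _ hi]
  have h2 : ∑ k ∈ (active n).erase i, N.κ k * n k ^ N.α * isoelasticUtility N.α (Λ k)
      ≤ (∑ k, w k) * B := by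
    rw [Finset.sum_mul]
    refine (Finset.sum_le_sum fun k hk => ?_).trans
      (Finset.sum_le_sum_of_subset_of_nonneg (Finset.subset_univ _)
        fun k _ _ => mul_nonneg (hw0 k) hB0)
    exact mul_le_mul_of_nonneg_left (hle k (Finset.mem_of_mem_erase hk)) (hw0 k)
  simp only [hw] at h1 h2
  linarith

theorem exists_isFairAllocation {n : EuclideanSpace ℝ I} (hn : ∀ i, 0 ≤ n i) :
    ∃ Λ, N.IsFairAllocation n Λ := by
  have hρ : (active n : Set I).indicator N.ρ ∈ N.feasible n :=
    N.indicator_mem_feasible n (fun i => (N.ρ_pos i).le) N.sum_A_mul_ρ_le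
  rcases lt_or_ge N.α 1 with hα | hα
  · obtain ⟨Λ, hΛ, hmax⟩ := (N.isCompact_feasible n).exists_isMaxOn ⟨_, hρ⟩
      (N.continuousOn_gain hn fun Λ hΛ i _ => ⟨hΛ.1 i, fun h => absurd h (not_le.2 hα)⟩)
    refine ⟨Λ, hΛ, fun Λ' hΛ' => ?_⟩
    rw [N.objective_eq_gain hn fun h => absurd h (not_le.2 hα),
      N.objective_eq_gain hn fun h => absurd h (not_le.2 hα)]
    exact EReal.coe_le_coe_iff.2 (hmax hΛ')
  · obtain ⟨l, hl0, hl⟩ := N.exists_pos_gain_lt_gain_ρ hn hα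
    set S : Set (I → ℝ) := N.feasible n ∩ ⋂ i ∈ active n, {Λ | l ≤ Λ i} with hS
    have hSc : IsCompact S := (N.isCompact_feasible n).inter_right
      (isClosed_biInter fun i _ => isClosed_le continuous_const (continuous_apply i))
    have hmem : ∀ Λ ∈ N.feasible n, (∀ i ∈ active n, 0 < Λ i) → N.gain n N.ρ ≤ N.gain n Λ →
        Λ ∈ S := by
      refine fun Λ hΛ hpos hle => ⟨hΛ, ?_⟩
      simp only [Set.mem_iInter, Set.mem_ofPred_eq]
      intro i hi
      by_contra hlt
      exact absurd (hl Λ hΛ hpos ⟨i, hi, not_le.1 hlt⟩) (not_lt.2 hle)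
    have hSpos : ∀ Λ ∈ S, ∀ i ∈ active n, 0 < Λ i := by
      intro Λ hΛ i hi
      have := hΛ.2
      simp only [Set.mem_iInter, Set.mem_ofPred_eq] at this
      exact hl0.trans_le (this i hi)
    have hρS := hmem _ hρ
      (fun i hi => by rw [Set.indicator_of_mem (Finset.mem_coe.2 hi)]; exact N.ρ_pos i)
      (N.gain_indicator hn N.ρ).ge
    obtain ⟨Λ, hΛ, hmax⟩ := hSc.exists_isMaxOn ⟨_, hρS⟩
      (N.continuousOn_gain hn fun Λ hΛ i hi => ⟨(hSpos Λ hΛ i hi).le, fun _ => hSpos Λ hΛ i hi⟩)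
    refine ⟨Λ, hΛ.1, fun Λ' hΛ' => ?_⟩
    by_cases h0 : ∃ i ∈ active n, Λ' i = 0
    · obtain ⟨i, hi, h0⟩ := h0
      rw [N.objective_eq_bot hα hi h0]
      exact bot_le
    · push Not at h0
      rw [N.objective_eq_gain hn fun _ => h0,
        N.objective_eq_gain hn fun _ i hi => (hSpos Λ hΛ i hi).ne']
      refine EReal.coe_le_coe_iff.2 ?_
      rcases le_total (N.gain n N.ρ) (N.gain n Λ') with hle | hle
      · exact hmax (hmem Λ' hΛ' (fun i hi => (hΛ'.1 i).lt_of_ne' (h0 i hi)) hle)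
      · refine hle.trans ?_
        rw [← N.gain_indicator hn]
        exact hmax hρS

theorem isFairAllocation_allocation {n : EuclideanSpace ℝ I} (hn : ∀ i, 0 ≤ n i) :
    N.IsFairAllocation n (N.allocation n) :=
  Classical.epsilon_spec (N.exists_isFairAllocation hn)

theorem allocation_ne_zero {n : EuclideanSpace ℝ I} (hn : ∀ i, 0 ≤ n i) (hα : 1 ≤ N.α) {i : I}
    (hi : i ∈ active n) : N.allocation n i ≠ 0 := by
  intro h0
  have h := (N.isFairAllocation_allocation hn).2 _
    (N.indicator_mem_feasible n (fun i => (N.ρ_pos i).le) N.sum_A_mul_ρ_le)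
  rw [N.objective_eq_bot hα hi h0, N.objective_eq_gain hn fun _ i hi => by
    rw [Set.indicator_of_mem (Finset.mem_coe.2 hi)]; exact (N.ρ_pos i).ne'] at h
  exact EReal.coe_ne_bot _ (le_bot_iff.1 h)

theorem gain_le_gain_allocation {n : EuclideanSpace ℝ I} (hn : ∀ i, 0 ≤ n i) {Λ : I → ℝ}
    (h0 : ∀ i, 0 < Λ i) (hC : ∀ j, ∑ i, N.A j i * Λ i ≤ N.C j) :
    N.gain n Λ ≤ N.gain n (N.allocation n) := by
  have h := (N.isFairAllocation_allocation hn).2 _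
    (N.indicator_mem_feasible n (fun i => (h0 i).le) hC)
  rw [N.objective_eq_gain hn fun h1 i hi => N.allocation_ne_zero hn h1 hi,
    N.objective_eq_gain hn fun _ i hi => by
      rw [Set.indicator_of_mem (Finset.mem_coe.2 hi)]; exact (h0 i).ne',
    N.gain_indicator hn] at h
  exact EReal.coe_le_coe_iff.1 h

/-! ### The drift -/

/-- The gradient of the objective at the load vector `ρ`, extended by `0` to the routes that are
not active. -/
noncomputable def marginal (n : EuclideanSpace ℝ I) (i : I) : ℝ :=
  N.κ i * N.ρ i ^ (-N.α) * n i ^ N.α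

theorem marginal_eq_zero {n : EuclideanSpace ℝ I} {i : I} (hi : n i = 0) :
    N.marginal n i = 0 := by
  rw [marginal, hi, Real.zero_rpow N.α_pos.ne', mul_zero]

/-- The rate at which the Lyapunov function `lyapunov` decreases along fluid model solutions, with
the sign that makes it nonnegative. -/
noncomputable def drift (n : EuclideanSpace ℝ I) : ℝ :=
  ∑ i, N.marginal n i * (N.allocation n i - N.ρ i)

theorem term_le_marginal_mul {n : EuclideanSpace ℝ I} (hn : ∀ i, 0 ≤ n i) (i : I) :
    N.κ i * n i ^ N.α * isoelasticUtility N.α (N.allocation n i)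
      - N.κ i * n i ^ N.α * isoelasticUtility N.α (N.ρ i)
      ≤ N.marginal n i * (N.allocation n i - N.ρ i) := by
  have hw0 : 0 ≤ N.κ i * n i ^ N.α := mul_nonneg (N.κ_pos i).le (Real.rpow_nonneg (hn i) _)
  by_cases hi : i ∈ active n
  · have h0 := (N.isFairAllocation_allocation hn).1.1 i
    have := mul_le_mul_of_nonneg_left (isoelasticUtility_le_tangent N.α_pos (N.ρ_pos i) h0
      fun h1 => h0.lt_of_ne' (N.allocation_ne_zero hn h1 hi)) hw0
    unfold marginal
    linarith
  · rw [N.marginal_eq_zero (eq_zero_of_notMem_active hn hi), eq_zero_of_notMem_active hn hi,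
      Real.zero_rpow N.α_pos.ne']
    simp

theorem gain_sub_gain_ρ_le_drift {n : EuclideanSpace ℝ I} (hn : ∀ i, 0 ≤ n i) :
    N.gain n (N.allocation n) - N.gain n N.ρ ≤ N.drift n := by
  unfold gain drift
  rw [← Finset.sum_sub_distrib]
  exact Finset.sum_le_sum fun i _ => N.term_le_marginal_mul hn i

theorem drift_nonneg {n : EuclideanSpace ℝ I} (hn : ∀ i, 0 ≤ n i) : 0 ≤ N.drift n := by
  linarith [N.gain_sub_gain_ρ_le_drift hn, N.gain_le_gain_allocation hn N.ρ_pos N.sum_A_mul_ρ_le]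

theorem drift_pos {n : EuclideanSpace ℝ I} (hn : ∀ i, 0 ≤ n i) {i : I} (hi : i ∈ active n)
    (hne : N.allocation n i ≠ N.ρ i) : 0 < N.drift n := by
  have h0 := (N.isFairAllocation_allocation hn).1.1 i
  have hw0 : 0 < N.κ i * n i ^ N.α :=
    mul_pos (N.κ_pos i) (Real.rpow_pos_of_pos (mem_active.1 hi) _)
  have hlt := mul_lt_mul_of_pos_left (isoelasticUtility_lt_tangent N.α_pos (N.ρ_pos i) h0
      (fun h1 => h0.lt_of_ne' (N.allocation_ne_zero hn h1 hi)) hne) hw0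
  have : N.gain n (N.allocation n) - N.gain n N.ρ < N.drift n := by
    unfold gain drift
    rw [← Finset.sum_sub_distrib]
    refine Finset.sum_lt_sum (fun k _ => N.term_le_marginal_mul hn k) ⟨i, Finset.mem_univ i, ?_⟩
    unfold marginal
    linarith
  linarith [N.gain_le_gain_allocation hn N.ρ_pos N.sum_A_mul_ρ_le]

/-! ### The Lyapunov function -/

/-- The Lyapunov function of the fluid model. Its partial derivative in `n i` is
`marginal n i / μ i`. -/
noncomputable def lyapunov (n : EuclideanSpace ℝ I) : ℝ :=
  ∑ i, N.κ i * N.ρ i ^ (-N.α) / (N.μ i * (N.α + 1)) * n i ^ (N.α + 1)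

theorem lyapunov_coeff_pos (i : I) : 0 < N.κ i * N.ρ i ^ (-N.α) / (N.μ i * (N.α + 1)) :=
  div_pos (mul_pos (N.κ_pos i) (Real.rpow_pos_of_pos (N.ρ_pos i) _))
    (mul_pos (N.μ_pos i) (by linarith [N.α_pos]))

/-- The workload of resource `j` in state `n`. -/
noncomputable def workload (j : J) (n : EuclideanSpace ℝ I) : ℝ := ∑ i, N.A j i * (n i / N.μ i)

theorem continuous_lyapunov : Continuous N.lyapunov := by
  unfold lyapunov
  refine continuous_finsetSum _ fun i _ => continuous_const.mul ?_
  exact Continuous.rpow_const (by fun_prop) fun _ => Or.inr (by linarith [N.α_pos])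

theorem continuous_marginal (i : I) : Continuous fun n => N.marginal n i := by
  unfold marginal
  exact continuous_const.mul (Continuous.rpow_const (by fun_prop) fun _ => Or.inr N.α_pos.le)

theorem lyapunov_nonneg {n : EuclideanSpace ℝ I} (hn : ∀ i, 0 ≤ n i) : 0 ≤ N.lyapunov n :=
  Finset.sum_nonneg fun i _ => mul_nonneg (N.lyapunov_coeff_pos i).le (Real.rpow_nonneg (hn i) _)

theorem lyapunov_tangent_le {n m : EuclideanSpace ℝ I} (hn : ∀ i, 0 ≤ n i) (hm : ∀ i, 0 ≤ m i) :
    N.lyapunov n + ∑ i, N.marginal n i * ((m i - n i) / N.μ i) ≤ N.lyapunov m := by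
  unfold lyapunov
  rw [← Finset.sum_add_distrib]
  refine Finset.sum_le_sum fun i _ => ?_
  have h := mul_le_mul_of_nonneg_left (rpow_add_one_tangent_le N.α_pos (hn i) (hm i))
    (N.lyapunov_coeff_pos i).le
  refine le_trans (le_of_eq ?_) h
  have h1 : N.α + 1 ≠ 0 := by linarith [N.α_pos]
  have h2 := (N.μ_pos i).ne'
  unfold marginal
  field_simp

theorem exists_bound_of_lyapunov_le (B : ℝ) :
    ∃ b, 0 ≤ b ∧ ∀ n : EuclideanSpace ℝ I, (∀ i, 0 ≤ n i) → N.lyapunov n ≤ B → ∀ i, n i ≤ b := by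
  set a : I → ℝ := fun i => N.κ i * N.ρ i ^ (-N.α) / (N.μ i * (N.α + 1)) with ha
  have ha0 : ∀ i, 0 < a i := N.lyapunov_coeff_pos
  have hs0 : ∀ i, 0 ≤ |B| / a i := fun i => div_nonneg (abs_nonneg B) (ha0 i).le
  have hs : 0 ≤ ∑ i, |B| / a i := Finset.sum_nonneg fun i _ => hs0 i
  refine ⟨∑ i, |B| / a i + 1, by positivity, fun n hn hB i => ?_⟩
  have h1 : a i * n i ^ (N.α + 1) ≤ |B| :=
    (Finset.single_le_sum (f := fun i => a i * n i ^ (N.α + 1))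
      (fun k _ => mul_nonneg (ha0 k).le (Real.rpow_nonneg (hn k) _)) (Finset.mem_univ i)).trans
      (hB.trans (le_abs_self B))
  have h2 : n i ^ (N.α + 1) ≤ |B| / a i := by
    rw [le_div_iff₀ (ha0 i)]
    linarith
  have h3 := Finset.single_le_sum (f := fun i => |B| / a i) (fun k _ => hs0 k) (Finset.mem_univ i)
  have h4 := rpow_add_one_tangent_le N.α_pos zero_le_one (hn i)
  simp only [Real.one_rpow] at h4
  rcases le_total (n i) 1 with h | h
  · linarith [hs0 i]
  · nlinarith [N.α_pos]

theorem isCompact_setOf_lyapunov_le (B : ℝ) :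
    IsCompact {n : EuclideanSpace ℝ I | (∀ i, 0 ≤ n i) ∧ N.lyapunov n ≤ B} := by
  obtain ⟨b, -, hb⟩ := N.exists_bound_of_lyapunov_le B
  have hK : IsCompact (WithLp.toLp 2 '' Set.Icc (0 : I → ℝ) fun _ => b : Set (EuclideanSpace ℝ I)) :=
    isCompact_Icc.image (PiLp.continuous_toLp 2 _)
  refine hK.of_isClosed_subset ?_ fun n hn => ⟨n.ofLp, ⟨hn.1, hb n hn.1 hn.2⟩, rfl⟩
  refine IsClosed.and ?_ (isClosed_le N.continuous_lyapunov continuous_const)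
  rw [Set.ofPred_forall]
  exact isClosed_iInter fun i => isClosed_le continuous_const (by fun_prop)

/-! ### Improving states and the drift -/

/-- The state `m` carries at least the workload of `n` on every resource of critical load, and
lies lower than `n` by at least `η` with respect to the Lyapunov function. -/
def ImprovesBy (η : ℝ) (n m : EuclideanSpace ℝ I) : Prop :=
  (∀ i, 0 ≤ m i) ∧
    (∀ j, ∑ i, N.A j i * N.ρ i = N.C j → N.workload j n ≤ N.workload j m) ∧
    N.lyapunov m ≤ N.lyapunov n - η

/-- A quantitative lower bound of the drift. If `m` improves on `n`, then `(n - m) / μ` is, from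
the allocation `ρ`, a feasible direction of increase of the objective in state `n`. -/
theorem exists_pos_le_drift (B : ℝ) {η : ℝ} (hη : 0 < η) :
    ∃ δ > 0, ∀ n m : EuclideanSpace ℝ I, (∀ i, 0 ≤ n i) → N.lyapunov n ≤ B →
      N.ImprovesBy η n m → δ ≤ N.drift n := by
  obtain ⟨b, hb0, hb⟩ := N.exists_bound_of_lyapunov_le B
  -- `Y` bounds the directions, `Q` the weights of the objective; `e` is chosen such that the
  -- first order errors cost at most half of the gain `s * η`.
  have hY0 : ∀ i, 0 ≤ b / N.μ i := fun i => div_nonneg hb0 (N.μ_pos i).le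
  set Y : ℝ := ∑ i, b / N.μ i with hY
  set Q : ℝ := ∑ i, N.κ i * b ^ N.α with hQ
  have hQ0 : 0 ≤ Q :=
    Finset.sum_nonneg fun i _ => mul_nonneg (N.κ_pos i).le (Real.rpow_nonneg hb0 _)
  set e : ℝ := η / (2 * (Q + 1)) with he
  have he0 : 0 < e := by positivity
  have heQ : e * Q ≤ η / 2 := by
    rw [he, div_mul_eq_mul_div, div_le_div_iff₀ (by positivity) (by positivity)]
    nlinarith
  have hev1 : ∀ᶠ s in 𝓝[>] (0 : ℝ), ∀ i, ∀ y, |y| ≤ Y → 0 < N.ρ i + s * y ∧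
      isoelasticUtility N.α (N.ρ i) + s * (N.ρ i ^ (-N.α) * y - e)
        ≤ isoelasticUtility N.α (N.ρ i + s * y) :=
    eventually_all.2 fun i => eventually_isoelasticUtility_expansion N.α (N.ρ_pos i) Y he0
  have hev2 : ∀ᶠ s in 𝓝[>] (0 : ℝ), ∀ j, ∑ i, N.A j i * N.ρ i ≠ N.C j →
      s * ∑ i, N.A j i * Y < N.C j - ∑ i, N.A j i * N.ρ i := by
    refine eventually_all.2 fun j => ?_
    by_cases hj : ∑ i, N.A j i * N.ρ i = N.C j
    · exact Eventually.of_forall fun s h => absurd hj h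
    have hlt : 0 < N.C j - ∑ i, N.A j i * N.ρ i :=
      sub_pos.2 (lt_of_le_of_ne (N.sum_A_mul_ρ_le j) hj)
    have hc : Tendsto (fun s : ℝ => s * ∑ i, N.A j i * Y) (𝓝[>] 0) (𝓝 0) := by
      have : Continuous fun s : ℝ => s * ∑ i, N.A j i * Y := by fun_prop
      simpa using (this.tendsto 0).mono_left nhdsWithin_le_nhds
    filter_upwards [hc.eventually_lt_const hlt] with s hs _ using hs
  obtain ⟨s, ⟨h1, h2⟩, hs⟩ := ((hev1.and hev2).and self_mem_nhdsWithin).exists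
  have hs : 0 < s := hs
  refine ⟨s * (η / 2), by positivity, fun n m hn hnB ⟨hm, hw, hmn⟩ => ?_⟩
  set y : I → ℝ := fun i => (n i - m i) / N.μ i with hy
  have hyY : ∀ i, |y i| ≤ Y := fun i => by
    refine le_trans ?_ (Finset.single_le_sum (fun k _ => hY0 k) (Finset.mem_univ i))
    rw [hy, abs_div, abs_of_pos (N.μ_pos i)]
    refine div_le_div_of_nonneg_right (abs_le.2 ⟨?_, ?_⟩) (N.μ_pos i).le
    · linarith [hn i, hb m hm (by linarith) i]
    · linarith [hm i, hb n hn hnB i]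
  have hsum : ∀ j, ∑ i, N.A j i * y i = N.workload j n - N.workload j m := fun j => by
    unfold workload
    rw [← Finset.sum_sub_distrib]
    exact Finset.sum_congr rfl fun i _ => by rw [hy]; ring
  have hgain := N.gain_le_gain_allocation hn (Λ := fun i => N.ρ i + s * y i)
    (fun i => (h1 i _ (hyY i)).1) fun j => by
      have hexp : ∑ i, N.A j i * (N.ρ i + s * y i)
          = ∑ i, N.A j i * N.ρ i + s * ∑ i, N.A j i * y i := by
        rw [Finset.mul_sum, ← Finset.sum_add_distrib]
        exact Finset.sum_congr rfl fun i _ => by ring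
      rw [hexp]
      by_cases hj : ∑ i, N.A j i * N.ρ i = N.C j
      -- At critical load the direction does not raise the load; elsewhere there is slack.
      · have := hw j hj
        rw [hsum, hj]
        nlinarith
      · have h3 := h2 j hj
        have h4 : ∑ i, N.A j i * y i ≤ ∑ i, N.A j i * Y :=
          Finset.sum_le_sum fun i _ =>
            mul_le_mul_of_nonneg_left ((le_abs_self _).trans (hyY i)) (N.A_nonneg j i)
        nlinarith
  have hlower : N.gain n N.ρ + s * (∑ i, N.marginal n i * y i - e * Q)
      ≤ N.gain n fun i => N.ρ i + s * y i := by
    have h5 : ∑ i, N.κ i * n i ^ N.α ≤ Q := Finset.sum_le_sum fun i _ =>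
      mul_le_mul_of_nonneg_left (Real.rpow_le_rpow (hn i) (hb n hn hnB i) N.α_pos.le)
        (N.κ_pos i).le
    calc _ ≤ N.gain n N.ρ
          + s * (∑ i, N.marginal n i * y i - e * ∑ i, N.κ i * n i ^ N.α) := by gcongr
      _ = ∑ i, N.κ i * n i ^ N.α *
          (isoelasticUtility N.α (N.ρ i) + s * (N.ρ i ^ (-N.α) * y i - e)) := by
        unfold gain marginal
        rw [Finset.mul_sum, ← Finset.sum_sub_distrib, Finset.mul_sum, ← Finset.sum_add_distrib]
        exact Finset.sum_congr rfl fun i _ => by ring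
      _ ≤ _ := Finset.sum_le_sum fun i _ => mul_le_mul_of_nonneg_left (h1 i _ (hyY i)).2
          (mul_nonneg (N.κ_pos i).le (Real.rpow_nonneg (hn i) _))
  have htan := N.lyapunov_tangent_le hn hm
  have hneg : ∑ i, N.marginal n i * ((m i - n i) / N.μ i) = -∑ i, N.marginal n i * y i := by
    rw [← Finset.sum_neg_distrib]
    exact Finset.sum_congr rfl fun i _ => by rw [hy]; ring
  have hfin : s * (η / 2) ≤ s * (∑ i, N.marginal n i * y i - e * Q) :=
    mul_le_mul_of_nonneg_left (by linarith) hs.le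
  linarith [N.gain_sub_gain_ρ_le_drift hn]

/-! ### States away from the invariant manifold -/

/-- The constant function `n` is a fluid model solution if `Λ(n)` agrees with `ρ` on the active
routes. -/
theorem mem_invariantManifold {n : EuclideanSpace ℝ I} (hn : ∀ i, 0 ≤ n i)
    (h : ∀ i ∈ active n, N.allocation n i = N.ρ i) : n ∈ N.invariantManifold := by
  refine ⟨hn, fun _ => n, ⟨fun _ _ => hn, fun i T _ => ?_, fun t _ _ i hi => ?_,
    fun t _ _ i _ => deriv_const _ _, fun t _ _ j => ?_⟩, fun _ _ => rfl⟩
  · exact (LipschitzWith.const (n i)).lipschitzOnWith.absolutelyContinuousOnInterval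
  · rw [deriv_const, h i (mem_active.2 hi), ρ, mul_div_cancel₀ _ (N.μ_pos i).ne', sub_self]
  · rw [Finset.sum_congr rfl fun i hi => by rw [h i hi], sum_active_add_sum_inactive hn]
    exact N.sum_A_mul_ρ_le j

/-- Outside of the invariant manifold, moving in the direction `μ (ρ - Λ(n))` improves on `n`. -/
theorem exists_lyapunov_lt {n : EuclideanSpace ℝ I} (hn : ∀ i, 0 ≤ n i)
    (hM : n ∉ N.invariantManifold) :
    ∃ m : EuclideanSpace ℝ I, (∀ i, 0 ≤ m i) ∧
      (∀ j, ∑ i, N.A j i * N.ρ i = N.C j → N.workload j n ≤ N.workload j m) ∧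
      N.lyapunov m < N.lyapunov n := by
  obtain ⟨k, hk, hne⟩ : ∃ i ∈ active n, N.allocation n i ≠ N.ρ i := by
    by_contra! h
    exact hM (N.mem_invariantManifold hn h)
  have hdrift := N.drift_pos hn hk hne
  obtain ⟨hΛ0, hΛ1, hΛC⟩ := (N.isFairAllocation_allocation hn).1
  set z : EuclideanSpace ℝ I := WithLp.toLp 2 fun i => N.μ i * (N.ρ i - N.allocation n i) with hz
  have hcont : Continuous fun s : ℝ => n + s • z := by fun_prop
  have hev1 : ∀ᶠ s in 𝓝[>] (0 : ℝ), ∀ i, 0 ≤ (n + s • z) i := by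
    refine eventually_all.2 fun i => ?_
    by_cases hi : i ∈ active n
    · have hc : Continuous fun s : ℝ => (n + s • z) i := by fun_prop
      have ht := (hc.tendsto 0).mono_left (nhdsWithin_le_nhds (s := Set.Ioi 0))
      simp only [zero_smul, add_zero] at ht
      filter_upwards [ht.eventually_const_lt (mem_active.1 hi)] with s hs using hs.le
    -- On an inactive route the allocation is `0`, so that the direction is `μ i * ρ i > 0`.
    · filter_upwards [self_mem_nhdsWithin] with s hs
      have hs : 0 < s := hs
      have : 0 ≤ s * (N.μ i * N.ρ i) :=
        mul_nonneg hs.le (mul_nonneg (N.μ_pos i).le (N.ρ_pos i).le)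
      simpa [hz, hΛ1 i hi, eq_zero_of_notMem_active hn hi] using this
  have hev2 : ∀ᶠ s in 𝓝[>] (0 : ℝ),
      0 < ∑ i, N.marginal (n + s • z) i * (N.allocation n i - N.ρ i) := by
    have hc : Continuous fun s : ℝ =>
        ∑ i, N.marginal (n + s • z) i * (N.allocation n i - N.ρ i) :=
      continuous_finsetSum _ fun i _ => ((N.continuous_marginal i).comp hcont).mul continuous_const
    have ht := (hc.tendsto 0).mono_left (nhdsWithin_le_nhds (s := Set.Ioi 0))
    simp only [zero_smul, add_zero] at ht
    exact ht.eventually_const_lt hdrift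
  obtain ⟨s, ⟨h1, h2⟩, hs⟩ := ((hev1.and hev2).and self_mem_nhdsWithin).exists
  have hs : 0 < s := hs
  have hzi : ∀ i, (n + s • z) i = n i + s * (N.μ i * (N.ρ i - N.allocation n i)) := fun i => by
    simp [hz]
  refine ⟨n + s • z, h1, fun j hj => ?_, ?_⟩
  · have hsum : ∑ i, N.A j i * N.allocation n i ≤ N.C j := by
      rw [← Finset.sum_subset (Finset.subset_univ (active n)) fun i _ hi => by
        rw [hΛ1 i hi, mul_zero]]
      exact hΛC j
    have : N.workload j (n + s • z) = N.workload j n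
        + s * (∑ i, N.A j i * N.ρ i - ∑ i, N.A j i * N.allocation n i) := by
      unfold workload
      rw [← Finset.sum_sub_distrib, Finset.mul_sum, ← Finset.sum_add_distrib]
      refine Finset.sum_congr rfl fun i _ => ?_
      have := (N.μ_pos i).ne'
      rw [hzi]
      field_simp
    rw [this, hj]
    nlinarith
  · -- The tangent at the new state is used, so that continuity of `marginal` suffices.
    have htan := N.lyapunov_tangent_le h1 hn
    have : ∑ i, N.marginal (n + s • z) i * ((n i - (n + s • z) i) / N.μ i)
        = s * ∑ i, N.marginal (n + s • z) i * (N.allocation n i - N.ρ i) := by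
      rw [Finset.mul_sum]
      refine Finset.sum_congr rfl fun i _ => ?_
      have := (N.μ_pos i).ne'
      rw [hzi]
      field_simp
      ring
    rw [this] at htan
    have := mul_pos hs h2
    linarith

/-- The uniform version of `exists_lyapunov_lt` away from the invariant manifold. -/
theorem exists_improvesBy (B : ℝ) {ε : ℝ} (hε : 0 < ε) :
    ∃ η > 0, ∀ n : EuclideanSpace ℝ I, (∀ i, 0 ≤ n i) → N.lyapunov n ≤ B →
      ε ≤ Metric.infDist n N.invariantManifold → ∃ m, N.ImprovesBy η n m := by
  set K : Set (EuclideanSpace ℝ I) := {n | (∀ i, 0 ≤ n i) ∧ N.lyapunov n ≤ B} ∩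
    {n | ε ≤ Metric.infDist n N.invariantManifold} with hK
  have hKc : IsCompact K := (N.isCompact_setOf_lyapunov_le B).inter_right
    (isClosed_le continuous_const (Metric.continuous_infDist_pt _))
  have key : ∃ η > 0, ∀ n ∈ K, ∃ m, N.ImprovesBy η n m := by
    refine hKc.induction_on (p := fun S => ∃ η > 0, ∀ n ∈ S, ∃ m, N.ImprovesBy η n m)
      ⟨1, one_pos, by simp⟩ ?_ ?_ ?_
    · rintro S S' hSS' ⟨η, hη, h⟩
      exact ⟨η, hη, fun n hn => h n (hSS' hn)⟩
    · rintro S S' ⟨η, hη, h⟩ ⟨η', hη', h'⟩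
      refine ⟨min η η', lt_min hη hη', ?_⟩
      rintro n (hn | hn)
      · obtain ⟨m, h1, h2, h3⟩ := h n hn
        exact ⟨m, h1, h2, by linarith [min_le_left η η']⟩
      · obtain ⟨m, h1, h2, h3⟩ := h' n hn
        exact ⟨m, h1, h2, by linarith [min_le_right η η']⟩
    · rintro n₀ ⟨⟨hn₀, -⟩, hd⟩
      have hM : n₀ ∉ N.invariantManifold := fun hmem => by
        rw [Set.mem_ofPred_eq, Metric.infDist_zero_of_mem hmem] at hd
        linarith
      obtain ⟨m₀, hm₀, hw₀, hlt⟩ := N.exists_lyapunov_lt hn₀ hM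
      -- Adding the positive part of `n - n₀` to `m₀` keeps it nonnegative and makes up for the
      -- change of the workloads from `n₀` to `n`.
      set m : EuclideanSpace ℝ I → EuclideanSpace ℝ I :=
        fun n => WithLp.toLp 2 fun i => m₀ i + max (n i - n₀ i) 0 with hm
      have hmc : Continuous m := by
        refine (PiLp.continuous_toLp 2 _).comp (continuous_pi fun i => ?_)
        fun_prop
      have hm0 : m n₀ = m₀ := by
        ext i
        simp [hm]
      have ht : Tendsto (fun n => N.lyapunov n - N.lyapunov (m n)) (𝓝[K] n₀)
          (𝓝 (N.lyapunov n₀ - N.lyapunov m₀)) := by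
        have hc : Continuous fun n => N.lyapunov n - N.lyapunov (m n) :=
          N.continuous_lyapunov.sub (N.continuous_lyapunov.comp hmc)
        have := (hc.tendsto n₀).mono_left (nhdsWithin_le_nhds (s := K))
        rwa [hm0] at this
      refine ⟨_, ht.eventually_const_lt (half_lt_self (sub_pos.2 hlt)),
        (N.lyapunov n₀ - N.lyapunov m₀) / 2, half_pos (sub_pos.2 hlt), fun n hn => ⟨m n, ?_, ?_, ?_⟩⟩
      · exact fun i => add_nonneg (hm₀ i) (le_max_right _ _)
      · intro j hj
        have hle : N.workload j m₀ + (N.workload j n - N.workload j n₀) ≤ N.workload j (m n) := by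
          unfold workload
          rw [← Finset.sum_sub_distrib, ← Finset.sum_add_distrib]
          refine Finset.sum_le_sum fun i _ => ?_
          have h1 : (m₀ i + (n i - n₀ i)) / N.μ i ≤ m n i / N.μ i :=
            div_le_div_of_nonneg_right (add_le_add_right (le_max_left _ _) _) (N.μ_pos i).le
          have h2 := mul_le_mul_of_nonneg_left h1 (N.A_nonneg j i)
          refine le_trans (le_of_eq ?_) h2
          ring
        linarith [hw₀ j hj]
      · have hn' : (N.lyapunov n₀ - N.lyapunov m₀) / 2 < N.lyapunov n - N.lyapunov (m n) := hn
        linarith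
  obtain ⟨η, hη, h⟩ := key
  exact ⟨η, hη, fun n hn hB hd => h n ⟨⟨hn, hB⟩, hd⟩⟩

/-! ### Fluid model solutions -/

variable {N} {n : ℝ → EuclideanSpace ℝ I}

theorem IsFluidSolution.ae_differentiableAt (h : N.IsFluidSolution n) (T : ℝ) :
    ∀ᵐ t, t ∈ Set.Ioo 0 T → ∀ i, DifferentiableAt ℝ (fun s => n s i) t := by
  rcases le_or_gt T 0 with hT | hT
  · simp [Set.Ioo_eq_empty (not_lt.2 hT)]
  · have : ∀ᵐ t, ∀ i, t ∈ Set.uIcc 0 T → DifferentiableAt ℝ (fun s => n s i) t :=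
      MeasureTheory.ae_all_iff.2 fun i => (h.absolutelyContinuous i T hT.le).ae_differentiableAt
    filter_upwards [this] with t ht htT i
    exact ht i (by rw [Set.uIcc_of_le hT.le]; exact Set.Ioo_subset_Icc_self htT)

/-- The workload of a resource of critical load does not decrease. -/
theorem IsFluidSolution.workload_le (h : N.IsFluidSolution n) {j : J}
    (hj : ∑ i, N.A j i * N.ρ i = N.C j) {s t : ℝ} (hs : 0 ≤ s) (hst : s ≤ t) :
    N.workload j (n s) ≤ N.workload j (n t) := by
  have hac : AbsolutelyContinuousOnInterval (fun u => -N.workload j (n u)) s t := by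
    have : AbsolutelyContinuousOnInterval (fun u => ∑ i, -N.A j i / N.μ i * n u i) 0 t :=
      .fun_sum fun i _ => (h.absolutelyContinuous i t (hs.trans hst)).const_mul _
    have heq : (fun u => -N.workload j (n u)) = fun u => ∑ i, -N.A j i / N.μ i * n u i := by
      funext u
      unfold workload
      rw [← Finset.sum_neg_distrib]
      exact Finset.sum_congr rfl fun i _ => by ring
    rw [heq]
    refine this.mono ?_
    rw [Set.uIcc_of_le hst, Set.uIcc_of_le (hs.trans hst)]
    exact Set.Icc_subset_Icc_left hs
  have := hac.sub_le_of_ae_deriv_le (c := 0) hst ?_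
  · linarith
  filter_upwards [h.ae_differentiableAt t] with u hu hut
  have hu0 : 0 < u := hs.trans_lt hut.1
  have hd := hu ⟨hu0, hut.2⟩
  have hn := h.nonneg u hu0.le
  have hderiv : HasDerivAt (fun u => -N.workload j (n u))
      (-∑ i, N.A j i * (deriv (fun s => n s i) u / N.μ i)) u :=
    (HasDerivAt.fun_sum fun i _ => ((hd i).hasDerivAt.div_const _).const_mul _).neg
  rw [hderiv.deriv]
  -- On inactive routes the derivative is `0`; their load `ρ` is accounted for by the capacity
  -- constraint on fluid model solutions.
  have hsum : ∑ i, N.A j i * (deriv (fun s => n s i) u / N.μ i)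
      = ∑ i, N.A j i * N.ρ i - (∑ i ∈ active (n u), N.A j i * N.allocation (n u) i
        + ∑ i ∈ inactive (n u), N.A j i * N.ρ i) := by
    rw [← sum_active_add_sum_inactive hn fun i => N.A j i * N.ρ i,
      ← sum_active_add_sum_inactive hn, add_sub_add_right_eq_sub, ← Finset.sum_sub_distrib]
    rw [Finset.sum_eq_zero (s := inactive (n u)) fun i hi => by
      rw [h.deriv_of_eq_zero u hu0 hd i (mem_inactive.1 hi)]; simp, add_zero]
    refine Finset.sum_congr rfl fun i hi => ?_
    rw [h.deriv_of_pos u hu0 hd i (mem_active.1 hi), ρ]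
    have := (N.μ_pos i).ne'
    field_simp
  have := h.capacity u hu0 hd j
  rw [hsum, hj]
  linarith

/-- Decrease of the Lyapunov function at rate at least `δ` while the drift is at least `δ`. -/
theorem IsFluidSolution.lyapunov_sub_le (h : N.IsFluidSolution n) {δ s t : ℝ} (hs : 0 ≤ s)
    (hst : s ≤ t) (hδ : ∀ u ∈ Set.Ioo s t, δ ≤ N.drift (n u)) :
    N.lyapunov (n t) - N.lyapunov (n s) ≤ -δ * (t - s) := by
  have hac : AbsolutelyContinuousOnInterval (fun u => N.lyapunov (n u)) s t := by
    have : AbsolutelyContinuousOnInterval (fun u => N.lyapunov (n u)) 0 t :=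
      .fun_sum fun i _ => ((h.absolutelyContinuous i t (hs.trans hst)).rpow_const
        (by linarith [N.α_pos])).const_mul _
    refine this.mono ?_
    rw [Set.uIcc_of_le hst, Set.uIcc_of_le (hs.trans hst)]
    exact Set.Icc_subset_Icc_left hs
  refine hac.sub_le_of_ae_deriv_le hst ?_
  filter_upwards [h.ae_differentiableAt t] with u hu hut
  have hu0 : 0 < u := hs.trans_lt hut.1
  have hd := hu ⟨hu0, hut.2⟩
  have hn := h.nonneg u hu0.le
  have hderiv : HasDerivAt (fun u => N.lyapunov (n u)) (∑ i,
      N.κ i * N.ρ i ^ (-N.α) / (N.μ i * (N.α + 1)) *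
        (deriv (fun s => n s i) u * (N.α + 1) * n u i ^ (N.α + 1 - 1))) u :=
    HasDerivAt.fun_sum fun i _ => ((hd i).hasDerivAt.rpow_const
      (Or.inr (by linarith [N.α_pos]))).const_mul _
  rw [hderiv.deriv]
  have hsum : ∑ i, N.κ i * N.ρ i ^ (-N.α) / (N.μ i * (N.α + 1)) *
        (deriv (fun s => n s i) u * (N.α + 1) * n u i ^ (N.α + 1 - 1)) = -N.drift (n u) := by
    unfold drift
    rw [← Finset.sum_neg_distrib]
    refine Finset.sum_congr rfl fun i _ => ?_
    by_cases hi : i ∈ active (n u)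
    · rw [h.deriv_of_pos u hu0 hd i (mem_active.1 hi), add_sub_cancel_right, marginal]
      have h1 := (N.μ_pos i).ne'
      have h2 : N.α + 1 ≠ 0 := by linarith [N.α_pos]
      have h3 : N.ν i = N.μ i * N.ρ i := by rw [ρ]; field_simp
      rw [h3]
      field_simp
      ring
    · have h0 := eq_zero_of_notMem_active hn hi
      rw [h.deriv_of_eq_zero u hu0 hd i h0, N.marginal_eq_zero h0]
      ring
  rw [hsum]
  exact neg_le_neg (hδ u hut)

theorem IsFluidSolution.lyapunov_le (h : N.IsFluidSolution n) {s t : ℝ} (hs : 0 ≤ s)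
    (hst : s ≤ t) : N.lyapunov (n t) ≤ N.lyapunov (n s) := by
  have := h.lyapunov_sub_le (δ := 0) hs hst fun u hu =>
    N.drift_nonneg (h.nonneg u (hs.trans hu.1.le))
  linarith

end FairSharing.Network

theorem theorem5p2 {J I : Type*} [Fintype J] [DecidableEq J] [Fintype I]
    (N : FairSharing.Network J I) (R ε : ℝ) (hR : 0 < R) (hε : 0 < ε) :
    ∃ T : ℝ, 0 ≤ T ∧ ∀ n : ℝ → EuclideanSpace ℝ I, N.IsFluidSolution n → ‖n 0‖ ≤ R →
      ∀ t, T < t → Metric.infDist (n t) N.invariantManifold < ε := by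
  set B : ℝ := ∑ i, N.κ i * N.ρ i ^ (-N.α) / (N.μ i * (N.α + 1)) * R ^ (N.α + 1) with hB
  have hB0 : 0 ≤ B := Finset.sum_nonneg fun i _ =>
    mul_nonneg (N.lyapunov_coeff_pos i).le (Real.rpow_nonneg hR.le _)
  obtain ⟨η, hη, hη'⟩ := N.exists_improvesBy B hε
  obtain ⟨δ, hδ, hδ'⟩ := N.exists_pos_le_drift B hη
  refine ⟨B / δ, by positivity, fun n hn hn0 t ht => ?_⟩
  have ht0 : 0 < t := lt_of_le_of_lt (by positivity) ht
  have hinit : N.lyapunov (n 0) ≤ B := by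
    refine Finset.sum_le_sum fun i _ => mul_le_mul_of_nonneg_left
      (Real.rpow_le_rpow (hn.nonneg 0 le_rfl i) ?_ (by linarith [N.α_pos]))
      (N.lyapunov_coeff_pos i).le
    exact (le_abs_self _).trans ((PiLp.norm_apply_le (n 0) i).trans hn0)
  by_contra! hfar
  have hbound : ∀ u, 0 ≤ u → N.lyapunov (n u) ≤ B := fun u hu =>
    (hn.lyapunov_le le_rfl hu).trans hinit
  obtain ⟨m, hm, hw, hmn⟩ := hη' (n t) (hn.nonneg t ht0.le) (hbound t ht0.le) hfar
  -- By monotonicity in time, the competitor of `n t` is a competitor at all earlier times.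
  have hdec := hn.lyapunov_sub_le (δ := δ) le_rfl ht0.le fun u hu =>
    hδ' (n u) m (hn.nonneg u hu.1.le) (hbound u hu.1.le)
      ⟨hm, fun j hj => (hn.workload_le hj hu.1.le hu.2.le).trans (hw j hj),
        hmn.trans (by linarith [hn.lyapunov_le hu.1.le hu.2.le])⟩
  rw [div_lt_iff₀ hδ] at ht
  linarith [N.lyapunov_nonneg (hn.nonneg t ht0.le)]
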